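/- Let $\mathbb K$ be a field of characteristic $0$ and $V=\bigoplus_{i\in\mathbb Z}V^i$ a $\mathbb Z$-graded $\mathbb K$-vector space. Tensor products of homogeneous maps follow the Koszul rule $(f\otimes g)(x\otimes y)=(-1)^{|x||g|}f(x)\otimes g(y)$, $I_k$ is the identity of $V^{\otimes k}$, and for $\sigma\in\mathbb S_n$ let $\rho_\sigma(x_1\otimes\cdots\otimes x_n)=\epsilon(\sigma)\,x_{\sigma(1)}\otimes\cdots\otimes x_{\sigma(n)}$ for homogeneous $x_i$, where $\epsilon(\sigma)=\epsilon(\sigma;x_1,\dots,x_n)$ is the Koszul sign, defined by $x_1\wedge\cdots\wedge x_n=\epsilon(\sigma)\,x_{\sigma(1)}\wedge\cdots\wedge x_{\sigma(n)}$ in the graded symmetric power of $V$ (in which $x\wedge y=(-1)^{|x||y|}y\wedge x$). Put $\rho_{w_n}=\sum_{\sigma\in\mathbb S_n}\rho_\sigma$. Let $\{\hat\mu_n:V^{\otimes n}\to V\}_{n\ge1}$ be linear maps, homogeneous of degree $-1$. Then $(V,\{\hat\mu_n\})$ is called * an $A_\infty$-algebra if for all $n\ge1$: $\displaystyle\sum_{i+j=n+1}\sum_{m=0}^{i-1}\hat\mu_i\circ(I_m\otimes\hat\mu_j\otimes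 I_{i-m-1})=0$; * a $PL_\infty$-algebra if for all $n\ge 1$: $\hat\mu_n=\hat\mu_n\circ(\rho_\sigma\otimes I_1)$ for $\sigma\in\mathbb S_{n-1}$, and $\displaystyle\sum_{i+j=n+1}\sum_{m=0}^{i-1}\tfrac{1}{(i-1)!\,(j-1)!}\,\hat\mu_i\circ(I_m\otimes\hat\mu_j\otimes I_{i-m-1})\circ(\rho_{w_{n-1}}\otimes I_1)=0$; * an $L_\infty$-algebra if for all $n\ge 1$: $\hat\mu_n=\hat\mu_n\circ\rho_\sigma$ for $\sigma\in\mathbb S_n$, and $\displaystyle\sum_{i+j=n+1}\sum_{m=0}^{i-1}\tfrac{1}{i!\,j!}\,\hat\mu_i\circ(I_m\otimes\hat\mu_j\otimes I_{i-m-1})\circ\rho_{w_n}=0$. (All sums are over $i,j\ge1$.) **Theorem.** 1. If $(V,\{\hat{\mathfrak m}_n\})$ is an $A_\infty$-algebra, then the maps $\hat\gamma(\hat{\mathfrak m}_n):=\hat{\mathfrak m}_n\circ(\rho_{w_{n-1}}\otimes I_1)$, i.e. $\hat\gamma(\hat{\mathfrak m}_n)(x_1,\dots,x_n)=\sum_{\sigma\in\mathbb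 S_{n-1}}\epsilon(\sigma)\,\hat{\mathfrak m}_n(x_{\sigma(1)},\dots,x_{\sigma(n-1)},x_n)$, make $V$ a $PL_\infty$-algebra. 2. If $(V,\{\hat{\mathfrak p}_n\})$ is a $PL_\infty$-algebra, then the maps $\hat\beta(\hat{\mathfrak p}_n)(x_1,\dots,x_n):=\sum_{\sigma}\epsilon(\sigma)\,\hat{\mathfrak p}_n(x_{\sigma(1)},\dots,x_{\sigma(n)})$, the sum being over the $(n-1,1)$-unshuffles $\sigma\in\mathbb S_n$ (those with $\sigma(1)<\cdots<\sigma(n-1)$), make $V$ an $L_\infty$-algebra. -/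

import Mathlib

open scoped TensorProduct

noncomputable section

namespace HomotopyAlgebra

/-! Throughout, `V` is a `ℤ`-graded vector space over a field `K`: the homogeneous part of degree
`i` is the subspace `𝒱 i`, and `[DirectSum.Decomposition 𝒱]` says `V = ⨁ i, 𝒱 i`. -/

/-! ### Koszul signs -/

/-- The Koszul sign `ε(σ; x₁, …, xₙ)` for homogeneous `x₁, …, xₙ` of degrees `d₁, …, dₙ`,
determined by `x₁ ∧ ⋯ ∧ xₙ = ε(σ; x₁, …, xₙ) x_{σ(1)} ∧ ⋯ ∧ x_{σ(n)}`: every pair of elements whose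
order is reversed contributes the factor `(-1) ^ (product of their degrees)`. -/
def koszulSign {n : ℕ} (σ : Equiv.Perm (Fin n)) (d : Fin n → ℤ) : ℤˣ :=
  ∏ p : Fin n × Fin n with p.1 < p.2 ∧ σ p.2 < σ p.1, (d (σ p.1) * d (σ p.2)).negOnePow

/-- The Koszul sign depends on the degrees only through their parities. -/
theorem koszulSign_congr {n : ℕ} (σ : Equiv.Perm (Fin n)) {d d' : Fin n → ℤ}
    (h : ∀ i, d i % 2 = d' i % 2) : koszulSign σ d = koszulSign σ d' := by
  unfold koszulSign
  refine Finset.prod_congr rfl fun p _ => ?_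
  rw [Int.negOnePow_eq_iff, Int.even_iff]
  have h1 := h (σ p.1)
  have h2 := h (σ p.2)
  have : (d (σ p.1) * d (σ p.2)) % 2 = (d' (σ p.1) * d' (σ p.2)) % 2 := by
    rw [Int.mul_emod, h1, h2, ← Int.mul_emod]
  omega

section Graded

variable {K : Type*} [Field K] {V : Type*} [AddCommGroup V] [Module K V]
variable (𝒱 : ℤ → Submodule K V) [DirectSum.Decomposition 𝒱]

/-- The projection of `V` onto the sum of the `𝒱 i` with `i` even (`e = 0`) or odd (`e = 1`). -/
def parityProj (e : Fin 2) : V →ₗ[K] V :=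
  (DirectSum.toModule K ℤ V fun i => if i % 2 = (e : ℤ) then (𝒱 i).subtype else 0) ∘ₗ
    (DirectSum.decomposeLinearEquiv 𝒱).toLinearMap

theorem parityProj_of_mem (e : Fin 2) {i : ℤ} {x : V} (hx : x ∈ 𝒱 i) :
    parityProj 𝒱 e x = if i % 2 = (e : ℤ) then x else 0 := by
  have h : DirectSum.decompose 𝒱 x = DirectSum.lof K ℤ (fun i => 𝒱 i) i ⟨x, hx⟩ :=
    DirectSum.decompose_of_mem 𝒱 hx
  simp only [parityProj, LinearMap.comp_apply, LinearEquiv.coe_coe,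
    DirectSum.decomposeLinearEquiv_apply, h, DirectSum.toModule_lof]
  split_ifs <;> simp

/-- The linear map with `x ↦ (-1) ^ |x| x` on homogeneous elements. -/
def signMap : V →ₗ[K] V := parityProj 𝒱 0 - parityProj 𝒱 1

theorem signMap_of_mem {i : ℤ} {x : V} (hx : x ∈ 𝒱 i) : signMap 𝒱 x = ((i.negOnePow : ℤ) : K) • x := by
  rw [signMap, LinearMap.sub_apply, parityProj_of_mem 𝒱 0 hx, parityProj_of_mem 𝒱 1 hx]
  rcases Int.emod_two_eq_zero_or_one i with h | h
  · simp [h, Int.negOnePow_even i (Int.even_iff.2 h)]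
  · simp [h, Int.negOnePow_odd i (Int.odd_iff.2 h)]

/-! ### The right action of the symmetric group on tensor powers -/

/-- The action `ρ^{(1)}_σ` on `⊗ⁿ V`. It is the linear map with
`ρ_σ (x₁ ⊗ ⋯ ⊗ xₙ) = ε(σ; x₁, …, xₙ) x_{σ(1)} ⊗ ⋯ ⊗ x_{σ(n)}` for homogeneous `xᵢ`
(see `rho_tprod`), obtained by splitting every factor into its even and its odd part. -/
def rho {n : ℕ} (σ : Equiv.Perm (Fin n)) : ⨂[K]^n V →ₗ[K] ⨂[K]^n V :=
  PiTensorProduct.lift <| ∑ e : Fin n → Fin 2,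
    ((koszulSign σ (fun i => ((e i : ℕ) : ℤ)) : ℤ) : K) •
      ((PiTensorProduct.tprod K).compLinearMap
        fun i => parityProj 𝒱 (e (σ i))).domDomCongr σ

theorem rho_tprod {n : ℕ} (σ : Equiv.Perm (Fin n)) (x : Fin n → V) (d : Fin n → ℤ)
    (hx : ∀ i, x i ∈ 𝒱 (d i)) :
    rho 𝒱 σ (PiTensorProduct.tprod K x) =
      ((koszulSign σ d : ℤ) : K) • PiTensorProduct.tprod K (fun i => x (σ i)) := by
  have hlt : ∀ i, (d i % 2).toNat < 2 := fun i => by omega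
  have hval : ∀ i, ((d i % 2).toNat : ℤ) = d i % 2 := fun i => by omega
  simp only [rho, PiTensorProduct.lift.tprod, sum_apply, smul_apply,
    MultilinearMap.domDomCongr_apply, MultilinearMap.compLinearMap_apply]
  rw [Finset.sum_eq_single (fun i => (⟨(d i % 2).toNat, hlt i⟩ : Fin 2))]
  · have hk : koszulSign σ (fun i => ((d i % 2).toNat : ℤ)) = koszulSign σ d :=
      koszulSign_congr σ fun i => by rw [hval]; omega
    rw [hk]
    congr 2
    funext i
    rw [parityProj_of_mem 𝒱 _ (hx (σ i)), if_pos (hval _).symm]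
  · intro e _ he
    obtain ⟨i, hi⟩ := Function.ne_iff.1 he
    have hz : parityProj 𝒱 (e i) (x i) = 0 := by
      rw [parityProj_of_mem 𝒱 _ (hx i), if_neg]
      intro h
      apply hi
      apply Fin.ext
      simp only
      omega
    have h0 : PiTensorProduct.tprod K (fun j => parityProj 𝒱 (e (σ j)) (x (σ j))) = 0 :=
      (PiTensorProduct.tprod K).map_coord_zero (σ.symm i) (by simpa using hz)
    rw [h0, smul_zero]
  · intro h
    exact absurd (Finset.mem_univ _) h

/-- `ρ^{(1)}_{w_n}` for the integral `w_n = ∑_{σ ∈ 𝕊_n} σ` of the group algebra of `𝕊_n`. -/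
def rhoW (n : ℕ) : ⨂[K]^n V →ₗ[K] ⨂[K]^n V := ∑ σ : Equiv.Perm (Fin n), rho 𝒱 σ

/-- `f ⊗ I₁ : ⊗ⁿ⁺¹ V → ⊗ⁿ⁺¹ V` for a linear map `f : ⊗ⁿ V → ⊗ⁿ V`. -/
def tensorOne {n : ℕ} (f : ⨂[K]^n V →ₗ[K] ⨂[K]^n V) : ⨂[K]^(n + 1) V →ₗ[K] ⨂[K]^(n + 1) V :=
  (TensorPower.mulEquiv (n := n) (m := 1)).toLinearMap ∘ₗ
    TensorProduct.map f LinearMap.id ∘ₗ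
      (TensorPower.mulEquiv (n := n) (m := 1)).symm.toLinearMap

theorem tensorOne_rho_tprod {n : ℕ} (σ : Equiv.Perm (Fin n)) (x : Fin n → V) (y : V)
    (d : Fin n → ℤ) (hx : ∀ i, x i ∈ 𝒱 (d i)) :
    tensorOne (rho 𝒱 σ) (PiTensorProduct.tprod K (Fin.snoc x y : Fin (n + 1) → V)) =
      ((koszulSign σ d : ℤ) : K) •
        PiTensorProduct.tprod K (Fin.snoc (fun i => x (σ i)) y : Fin (n + 1) → V) := by
  have key : ∀ z : Fin n → V, TensorPower.mulEquiv (n := n) (m := 1)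
      (PiTensorProduct.tprod K z ⊗ₜ[K] PiTensorProduct.tprod K (fun _ : Fin 1 => y)) =
      PiTensorProduct.tprod K (Fin.snoc z y : Fin (n + 1) → V) := fun z => by
    have h := TensorPower.tprod_mul_tprod K z (fun _ : Fin 1 => y)
    rw [TensorPower.gMul_def] at h
    rw [h, Fin.append_right_eq_snoc]
  rw [← key, ← key, tensorOne, LinearMap.comp_apply, LinearMap.comp_apply, LinearEquiv.coe_coe,
    LinearEquiv.coe_coe, LinearEquiv.symm_apply_apply, TensorProduct.map_tmul,
    rho_tprod 𝒱 σ x d hx, ← TensorProduct.smul_tmul', map_smul,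
    LinearMap.id_apply]

/-! ### Insertion of an operation -/

/-- The factors of `(I_m ⊗ f ⊗ I_{a-m}) (x₀ ⊗ ⋯ ⊗ xₙ)`, where `f : ⊗ᵇ⁺¹ V → V` and `a + b = n`;
each of the first `m` factors has passed the operation `f` of degree `-1`. -/
def insertFun {a b n : ℕ} (h : a + b = n) (m : Fin (a + 1)) (f : ⨂[K]^(b + 1) V →ₗ[K] V)
    (x : Fin (n + 1) → V) (t : Fin (a + 1)) : V :=
  if t < m then signMap 𝒱 (x ⟨t, by omega⟩)
  else if t = m then f (PiTensorProduct.tprod K fun s : Fin (b + 1) => x ⟨m + s, by omega⟩)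
  else x ⟨t + b, by omega⟩

theorem insertFun_update {a b n : ℕ} (h : a + b = n) (m : Fin (a + 1))
    (f : ⨂[K]^(b + 1) V →ₗ[K] V) (x : Fin (n + 1) → V) (c : Fin (n + 1)) :
    ∃ (t : Fin (a + 1)) (L : V →ₗ[K] V), ∀ u : V,
      insertFun 𝒱 h m f (Function.update x c u) =
        Function.update (insertFun 𝒱 h m f x) t (L u) := by
  by_cases h1 : (c : ℕ) < m
  · refine ⟨⟨c, by omega⟩, signMap 𝒱, fun u => ?_⟩
    funext t
    by_cases ht : t = ⟨c, by omega⟩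
    · subst ht
      simp [insertFun, Fin.lt_def, h1]
    · have ht' : (t : ℕ) ≠ c := fun h' => ht (Fin.ext h')
      rw [Function.update_of_ne ht]
      unfold insertFun
      split_ifs with h2 h3
      · rw [Function.update_of_ne]
        simpa [Fin.ext_iff] using ht'
      · congr 2
        funext s
        rw [Function.update_of_ne]
        simp only [ne_eq, Fin.ext_iff]
        omega
      · rw [Function.update_of_ne]
        simp only [ne_eq, Fin.ext_iff, Fin.lt_def] at *
        omega
  by_cases h2 : (c : ℕ) ≤ m + b
  · let s₀ : Fin (b + 1) := ⟨c - m, by omega⟩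
    refine ⟨m, f ∘ₗ (PiTensorProduct.tprod K).toLinearMap
      (fun s : Fin (b + 1) => x ⟨m + s, by omega⟩) s₀, fun u => ?_⟩
    funext t
    by_cases ht : t = m
    · subst ht
      simp only [insertFun, lt_irrefl, if_false, if_true, Function.update_self,
        LinearMap.comp_apply, MultilinearMap.toLinearMap_apply]
      congr 2
      funext s
      by_cases hs : s = s₀
      · subst hs
        rw [Function.update_self]
        have : (⟨t + s₀, by omega⟩ : Fin (n + 1)) = c := by
          apply Fin.ext
          simp only [s₀]
          omega
        rw [this, Function.update_self]
      · rw [Function.update_of_ne hs, Function.update_of_ne]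
        simp only [ne_eq, Fin.ext_iff, s₀] at *
        omega
    · rw [Function.update_of_ne ht]
      unfold insertFun
      split_ifs with h3
      · rw [Function.update_of_ne]
        simp only [ne_eq, Fin.ext_iff, Fin.lt_def] at *
        omega
      · rw [Function.update_of_ne]
        simp only [ne_eq, Fin.ext_iff, Fin.lt_def] at *
        omega
  · refine ⟨⟨c - b, by omega⟩, LinearMap.id, fun u => ?_⟩
    funext t
    by_cases ht : t = ⟨c - b, by omega⟩
    · subst ht
      rw [Function.update_self]
      unfold insertFun
      rw [if_neg (by simp only [Fin.lt_def]; omega), if_neg (by simp only [Fin.ext_iff]; omega)]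
      have : (⟨(c : ℕ) - b + b, by omega⟩ : Fin (n + 1)) = c := by
        apply Fin.ext
        simp only
        omega
      rw [this, Function.update_self, LinearMap.id_apply]
    · rw [Function.update_of_ne ht]
      unfold insertFun
      split_ifs with h3 h4
      · rw [Function.update_of_ne]
        simp only [ne_eq, Fin.ext_iff, Fin.lt_def] at *
        omega
      · congr 2
        funext s
        rw [Function.update_of_ne]
        simp only [ne_eq, Fin.ext_iff]
        omega
      · rw [Function.update_of_ne]
        simp only [ne_eq, Fin.ext_iff, Fin.lt_def] at *
        omega

/-- The map `I_m ⊗ f ⊗ I_{a-m} : ⊗ⁿ⁺¹ V → ⊗ᵃ⁺¹ V` for an operation `f : ⊗ᵇ⁺¹ V → V` of degree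
`-1`, where `a + b = n` and `0 ≤ m ≤ a`. With the Koszul rule
`(g ⊗ f) (x ⊗ y) = (-1) ^ (|x| |f|) g x ⊗ f y` it sends `x₀ ⊗ ⋯ ⊗ xₙ` to
`(-1) ^ (|x₀| + ⋯ + |x_{m-1}|) x₀ ⊗ ⋯ ⊗ x_{m-1} ⊗ f (x_m ⊗ ⋯ ⊗ x_{m+b}) ⊗ x_{m+b+1} ⊗ ⋯ ⊗ xₙ`. -/
def insertMap {a b n : ℕ} (h : a + b = n) (m : Fin (a + 1)) (f : ⨂[K]^(b + 1) V →ₗ[K] V) :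
    ⨂[K]^(n + 1) V →ₗ[K] ⨂[K]^(a + 1) V :=
  PiTensorProduct.lift
    { toFun := fun x => PiTensorProduct.tprod K (insertFun 𝒱 h m f x)
      map_update_add' := by
        intro inst x c u v
        obtain rfl : inst = instDecidableEqFin (n + 1) := Subsingleton.elim _ _
        obtain ⟨t, L, hL⟩ := insertFun_update 𝒱 h m f x c
        rw [hL, hL, hL, map_add, MultilinearMap.map_update_add]
      map_update_smul' := by
        intro inst x c r u
        obtain rfl : inst = instDecidableEqFin (n + 1) := Subsingleton.elim _ _
        obtain ⟨t, L, hL⟩ := insertFun_update 𝒱 h m f x c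
        rw [hL, hL, map_smul, MultilinearMap.map_update_smul] }

theorem insertMap_tprod {a b n : ℕ} (h : a + b = n) (m : Fin (a + 1))
    (f : ⨂[K]^(b + 1) V →ₗ[K] V) (x : Fin (n + 1) → V) :
    insertMap 𝒱 h m f (PiTensorProduct.tprod K x) =
      PiTensorProduct.tprod K (insertFun 𝒱 h m f x) := by
  simp [insertMap]

/-! ### Homotopy algebras in the degree `-1` convention -/

variable (K V) in
/-- A collection of operations `μ̂_n : ⊗ⁿ V → V`, `n ≥ 1`. The operation of arity `n + 1` is
`μ n`. -/
abbrev Operations : Type _ := ∀ n : ℕ, ⨂[K]^(n + 1) V →ₗ[K] V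

/-- Every operation is homogeneous of degree `-1`. -/
def IsDegreeNegOne (μ : Operations K V) : Prop :=
  ∀ (n : ℕ) (d : Fin (n + 1) → ℤ) (x : Fin (n + 1) → V), (∀ i, x i ∈ 𝒱 (d i)) →
    μ n (PiTensorProduct.tprod K x) ∈ 𝒱 ((∑ i, d i) - 1)

/-! In the sums below, `p = (a, b)` runs over the pairs with `a + b = n`; the operations involved
have the arities `i = a + 1` and `j = b + 1`, and the equation is the one on `⊗ⁿ⁺¹ V`. -/

/-- `A_∞`-algebras: `∑_{i+j=n+1} ∑_{m=0}^{i-1} μ̂_i ∘ (I_m ⊗ μ̂_j ⊗ I_{i-m-1}) = 0` for all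
`n ≥ 1`. -/
structure IsAInfinity (μ : Operations K V) : Prop where
  degree : IsDegreeNegOne 𝒱 μ
  relation : ∀ n : ℕ,
    ∑ p : Finset.HasAntidiagonal.antidiagonal n, ∑ m : Fin (p.1.1 + 1),
      μ p.1.1 ∘ₗ insertMap 𝒱 (Finset.HasAntidiagonal.mem_antidiagonal.1 p.2) m (μ p.1.2) = 0

/-- `PL_∞`-algebras: `μ̂_n = μ̂_n ∘ (ρ_σ ⊗ I_1)` for `σ ∈ 𝕊_{n-1}`, and
`∑_{i+j=n+1} ∑_{m=0}^{i-1} 1/((i-1)!(j-1)!) μ̂_i ∘ (I_m ⊗ μ̂_j ⊗ I_{i-m-1}) ∘ (ρ_{w_{i+j-2}} ⊗ I_1)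
= 0` for all `n ≥ 1`. -/
structure IsPLInfinity (μ : Operations K V) : Prop where
  degree : IsDegreeNegOne 𝒱 μ
  symm : ∀ (n : ℕ) (σ : Equiv.Perm (Fin n)), μ n = μ n ∘ₗ tensorOne (rho 𝒱 σ)
  relation : ∀ n : ℕ,
    ∑ p : Finset.HasAntidiagonal.antidiagonal n, ∑ m : Fin (p.1.1 + 1),
      ((p.1.1.factorial : K) * (p.1.2.factorial : K))⁻¹ •
        (μ p.1.1 ∘ₗ insertMap 𝒱 (Finset.HasAntidiagonal.mem_antidiagonal.1 p.2) m (μ p.1.2) ∘ₗ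
          tensorOne (rhoW 𝒱 n)) = 0

/-- `L_∞`-algebras: `μ̂_n = μ̂_n ∘ ρ_σ` for `σ ∈ 𝕊_n`, and
`∑_{i+j=n+1} ∑_{m=0}^{i-1} 1/(i! j!) μ̂_i ∘ (I_m ⊗ μ̂_j ⊗ I_{i-m-1}) ∘ ρ_{w_{i+j-1}} = 0` for all
`n ≥ 1`. By symmetry the `i` summands with the same `(i, j)` agree, and the relation is the usual
`∑_{i+j=n+1} ∑_{σ ∈ Sh(j,i-1)} ε(σ) μ̂_i (μ̂_j (x_{σ(1)}, …, x_{σ(j)}), x_{σ(j+1)}, …, x_{σ(n)}) = 0`.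
-/
structure IsLInfinity (μ : Operations K V) : Prop where
  degree : IsDegreeNegOne 𝒱 μ
  symm : ∀ (n : ℕ) (σ : Equiv.Perm (Fin (n + 1))), μ n = μ n ∘ₗ rho 𝒱 σ
  relation : ∀ n : ℕ,
    ∑ p : Finset.HasAntidiagonal.antidiagonal n, ∑ m : Fin (p.1.1 + 1),
      (((p.1.1 + 1).factorial : K) * ((p.1.2 + 1).factorial : K))⁻¹ •
        (μ p.1.1 ∘ₗ insertMap 𝒱 (Finset.HasAntidiagonal.mem_antidiagonal.1 p.2) m (μ p.1.2) ∘ₗ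
          rhoW 𝒱 (n + 1)) = 0

/-! ### The commutators -/

/-- `γ̂(m̂_n) = m̂_n ∘ (ρ_{w_{n-1}} ⊗ I_1)`, that is,
`γ̂(m̂_n)(x₁, …, xₙ) = ∑_{σ ∈ 𝕊_{n-1}} ε(σ) m̂_n(x_{σ(1)}, …, x_{σ(n-1)}, xₙ)`. -/
def gammaHat (μ : Operations K V) : Operations K V :=
  fun n => μ n ∘ₗ tensorOne (rhoW 𝒱 n)

/-- The `(n, 1)`-unshuffles: the permutations `σ` with `σ(1) < ⋯ < σ(n)`. -/
def IsUnshuffleOne {n : ℕ} (σ : Equiv.Perm (Fin (n + 1))) : Prop :=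
  StrictMono fun i : Fin n => σ i.castSucc

open scoped Classical in
/-- `β̂(p̂_n) = p̂_n ∘ ∑_{σ ∈ Sh(n-1,1)} ρ_σ`, that is,
`β̂(p̂_n)(x₁, …, xₙ) = ∑_{σ ∈ Sh(n-1,1)} ε(σ) p̂_n(x_{σ(1)}, …, x_{σ(n)})`. -/
def betaHat (μ : Operations K V) : Operations K V :=
  fun n => μ n ∘ₗ ∑ σ : Equiv.Perm (Fin (n + 1)) with IsUnshuffleOne σ, rho 𝒱 σ

end Graded

end HomotopyAlgebra

end

/-!
Write `ρ_σ` for `rho 𝒱 σ` and `I_m ⊗ f ⊗ I` for `insertMap 𝒱 h m f`. Both halves rest on two facts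
about a map `W` into `⊗ⁿ⁺¹ V` that absorbs permutations, `ρ_P ∘ W = W`, where `P` runs over all
permutations (`W = rhoW 𝒱 (n + 1)`) or over those fixing the last place
(`W = tensorOne (rhoW 𝒱 n)`):

* permuting the inputs of `f` does nothing: `(I_m ⊗ (f ∘ ρ_τ) ⊗ I) ∘ W = (I_m ⊗ f ⊗ I) ∘ W`
  (`mem_inputAbsorbed`, `extendLast_mem_inputAbsorbed`);
* permuting the outputs only moves the place of `f`, when `f` has degree `-1`:
  `ρ_τ ∘ (I_m ⊗ f ⊗ I) ∘ W = (I_{τ⁻¹ m} ⊗ f ⊗ I) ∘ W`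
  (`mem_outputAbsorbed`, `extendLast_mem_outputAbsorbed`).

In the second situation `τ` is restricted to permutations that fix the last place; then the induced
permutation of the `n + 1` inputs fixes the last place too.

Because `ρ` is a right action (`rho_comp_rho`, from the cocycle identity `koszulSign_mul`), the `τ`
with either property form a submonoid, so it is enough to treat adjacent transpositions, where the
signs can be read off. The degree `-1` of `f` enters the signs only when the output of `f` is
exchanged with a neighbour (`rho_swap_comp_insertMap_castSucc`).

Hence, if the outer operation is symmetrized over a set `S` of permutations and the inner one over
a set `T`, the sum over `m` of all insertions, composed with `W`, is `|S| |T|` times the sum for the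
original operations (`sum_comp_insertMap_sum_rho`). For `γ̂` the sets are `𝕊_a` and `𝕊_b`, and
`a! b!` cancels the coefficient of the `PL_∞` relation, which leaves the `A_∞` relation composed
with `ρ_{w_n} ⊗ I_1`. For `β̂` they are the sets of `a + 1` and `b + 1` unshuffles, which turns
the coefficient `1 / ((a + 1)! (b + 1)!)` into `1 / (a! b!)`; as
`(ρ_{w_n} ⊗ I_1) ∘ ρ_{w_{n+1}} = n! ρ_{w_{n+1}}`, what is left is `1 / n!` times the `PL_∞` relation
composed with `ρ_{w_{n+1}}`. The symmetry of `β̂ p` follows from `n! β̂ p = p ∘ ρ_{w_{n+1}}`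
(`comp_rhoW_eq_factorial_smul_betaHat`).
-/

open scoped TensorProduct

namespace HomotopyAlgebra

/-! ### Koszul signs of composites, adjacent transpositions and extensions -/

/-- The permutation of `Fin (n + 1)` that acts as `σ` on the first `n` places and fixes the last
one. -/
def extendLast {n : ℕ} (σ : Equiv.Perm (Fin n)) : Equiv.Perm (Fin (n + 1)) :=
  finSuccEquivLast.symm.permCongr σ.optionCongr

@[simp]
theorem extendLast_castSucc {n : ℕ} (σ : Equiv.Perm (Fin n)) (i : Fin n) :
    extendLast σ i.castSucc = (σ i).castSucc := by
  simp [extendLast, Equiv.permCongr_apply]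

@[simp]
theorem extendLast_last {n : ℕ} (σ : Equiv.Perm (Fin n)) :
    extendLast σ (Fin.last n) = Fin.last n := by
  simp [extendLast, Equiv.permCongr_apply]

theorem extendLast_one (n : ℕ) : extendLast (1 : Equiv.Perm (Fin n)) = 1 := by
  ext i
  refine Fin.lastCases ?_ (fun i => ?_) i <;> simp

theorem extendLast_mul {n : ℕ} (σ τ : Equiv.Perm (Fin n)) :
    extendLast (σ * τ) = extendLast σ * extendLast τ := by
  ext i
  refine Fin.lastCases ?_ (fun i => ?_) i <;> simp

theorem extendLast_injective {n : ℕ} :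
    Function.Injective (extendLast : Equiv.Perm (Fin n) → Equiv.Perm (Fin (n + 1))) := by
  intro σ τ h
  ext i
  have := congrArg (fun π : Equiv.Perm (Fin (n + 1)) => ((π i.castSucc : Fin (n + 1)) : ℕ)) h
  simpa using this

theorem extendLast_swap {n : ℕ} (i j : Fin n) :
    extendLast (Equiv.swap i j) = Equiv.swap i.castSucc j.castSucc := by
  ext k
  refine Fin.lastCases ?_ (fun k => ?_) k
  · rw [extendLast_last, Equiv.swap_apply_of_ne_of_ne (Fin.castSucc_lt_last i).ne'
      (Fin.castSucc_lt_last j).ne']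
  · rw [extendLast_castSucc, Equiv.swap_apply_def, Equiv.swap_apply_def]
    simp only [Fin.castSucc_inj]
    split_ifs <;> rfl

theorem exists_extendLast_eq {n : ℕ} (σ : Equiv.Perm (Fin (n + 1)))
    (h : σ (Fin.last n) = Fin.last n) : ∃ τ, extendLast τ = σ := by
  refine ⟨Equiv.removeNone (finSuccEquivLast.permCongr σ), ?_⟩
  have hnone : finSuccEquivLast.permCongr σ none = none := by simp [Equiv.permCongr_apply, h]
  have hsome : ∀ i, ∃ j, finSuccEquivLast.permCongr σ (some i) = some j := fun i =>
    Option.ne_none_iff_exists'.1 fun hi => by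
      simpa using (finSuccEquivLast.permCongr σ).injective (hi.trans hnone.symm)
  have key : (Equiv.removeNone (finSuccEquivLast.permCongr σ)).optionCongr =
      finSuccEquivLast.permCongr σ := by
    refine Equiv.ext fun o => ?_
    cases o with
    | none => rw [hnone]; rfl
    | some i => exact Equiv.removeNone_some _ (hsome i)
  rw [extendLast, key]
  ext i
  simp [Equiv.permCongr_apply]

theorem prod_lt_comp_perm {n : ℕ} {M : Type*} [CommMonoid M] (τ : Equiv.Perm (Fin n))
    (F : Fin n → Fin n → M) (hF : ∀ i j, F i j = F j i) :
    ∏ p : Fin n × Fin n with p.1 < p.2, F (τ p.1) (τ p.2) =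
      ∏ p : Fin n × Fin n with p.1 < p.2, F p.1 p.2 := by
  -- The pairs `p.1 < p.2` stand for the unordered pairs, which `τ` permutes.
  let e : Equiv.Perm (Fin n) → Fin n × Fin n → Fin n × Fin n := fun π p =>
    if π p.1 < π p.2 then (π p.1, π p.2) else (π p.2, π p.1)
  have hmem : ∀ (π : Equiv.Perm (Fin n)) (p : Fin n × Fin n), p.1 < p.2 →
      (e π p).1 < (e π p).2 := fun π p hp => by
    have h : π p.1 ≠ π p.2 := fun h => hp.ne (π.injective h)
    by_cases h' : π p.1 < π p.2
    · simp [e, h']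
    · simpa [e, h'] using lt_of_le_of_ne (not_lt.1 h') h.symm
  have hinv : ∀ (π π' : Equiv.Perm (Fin n)) (_ : ∀ i, π' (π i) = i) (p : Fin n × Fin n),
      p.1 < p.2 → e π' (e π p) = p := fun π π' hπ p hp => by
    by_cases h' : π p.1 < π p.2
    · simp [e, h', hπ, hp]
    · simp [e, h', hπ, hp.not_gt]
  refine Finset.prod_nbij' (e τ) (e τ.symm) ?_ ?_ ?_ ?_ ?_
  · intro p hp
    exact Finset.mem_filter.2 ⟨Finset.mem_univ _, hmem _ _ (Finset.mem_filter.1 hp).2⟩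
  · intro p hp
    exact Finset.mem_filter.2 ⟨Finset.mem_univ _, hmem _ _ (Finset.mem_filter.1 hp).2⟩
  · intro p hp
    exact hinv _ _ τ.symm_apply_apply _ (Finset.mem_filter.1 hp).2
  · intro p hp
    exact hinv _ _ τ.apply_symm_apply _ (Finset.mem_filter.1 hp).2
  · intro p _
    by_cases h' : τ p.1 < τ p.2
    · simp [e, h']
    · simp [e, h', hF (τ p.1)]

theorem koszulSign_eq_prod_lt {n : ℕ} (σ : Equiv.Perm (Fin n)) (d : Fin n → ℤ) :
    koszulSign σ d = ∏ p : Fin n × Fin n with p.1 < p.2,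
      if σ p.2 < σ p.1 then (d (σ p.1) * d (σ p.2)).negOnePow else 1 := by
  rw [koszulSign, ← Finset.filter_filter, Finset.prod_filter]

/-- The cocycle identity for Koszul signs. It makes `rho` a right action. -/
theorem koszulSign_mul {n : ℕ} (σ τ : Equiv.Perm (Fin n)) (d : Fin n → ℤ) :
    koszulSign (σ * τ) d = koszulSign σ d * koszulSign τ (fun i => d (σ i)) := by
  -- `F` is the factor of `koszulSign σ d` belonging to an unordered pair of places.
  let F : Fin n → Fin n → ℤˣ := fun i j =>
    if (i < j ∧ σ j < σ i) ∨ (j < i ∧ σ i < σ j) then (d (σ i) * d (σ j)).negOnePow else 1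
  have hF : ∀ i j, F i j = F j i := fun i j => by
    simp only [F, mul_comm (d (σ i)), or_comm]
  have h1 : koszulSign σ d = ∏ p : Fin n × Fin n with p.1 < p.2, F p.1 p.2 := by
    rw [koszulSign_eq_prod_lt]
    refine Finset.prod_congr rfl fun p hp => ?_
    have hp : p.1 < p.2 := by simpa using hp
    simp [F, hp, hp.not_gt]
  rw [h1, ← prod_lt_comp_perm τ F hF, koszulSign_eq_prod_lt, koszulSign_eq_prod_lt τ,
    ← Finset.prod_mul_distrib]
  refine Finset.prod_congr rfl fun p hp => ?_
  have hp : p.1 < p.2 := by simpa using hp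
  have hτ : τ p.1 ≠ τ p.2 := fun h => hp.ne (τ.injective h)
  have hσ : σ (τ p.1) ≠ σ (τ p.2) := fun h => hτ (σ.injective h)
  simp only [F, Equiv.Perm.mul_apply]
  rcases lt_or_gt_of_ne hτ with h | h <;> rcases lt_or_gt_of_ne hσ with h' | h' <;>
    simp [h, h', h.not_gt, h'.not_gt, Int.units_mul_self]

theorem koszulSign_one {n : ℕ} (d : Fin n → ℤ) : koszulSign 1 d = 1 := by
  refine Finset.prod_eq_one fun p hp => ?_
  have hp := (Finset.mem_filter.1 hp).2
  exact absurd hp.1 hp.2.not_gt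

theorem koszulSign_swap {n : ℕ} (i : Fin n) (d : Fin (n + 1) → ℤ) :
    koszulSign (Equiv.swap i.castSucc i.succ) d = (d i.castSucc * d i.succ).negOnePow := by
  have : (Finset.univ.filter fun p : Fin (n + 1) × Fin (n + 1) => p.1 < p.2 ∧
      Equiv.swap i.castSucc i.succ p.2 < Equiv.swap i.castSucc i.succ p.1) =
      {(i.castSucc, i.succ)} := by
    ext ⟨p, q⟩
    rw [Finset.mem_filter, Finset.mem_singleton, Prod.mk.injEq, Equiv.swap_apply_def,
      Equiv.swap_apply_def]
    have hi : i.castSucc < i.succ := Fin.castSucc_lt_succ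
    split_ifs <;> simp only [Fin.ext_iff, Fin.lt_def, Fin.val_castSucc, Fin.val_succ,
      Finset.mem_univ, true_and] at * <;> omega
  rw [koszulSign, this, Finset.prod_singleton, Equiv.swap_apply_left, Equiv.swap_apply_right,
    mul_comm]

theorem koszulSign_extendLast {n : ℕ} (σ : Equiv.Perm (Fin n)) (d : Fin (n + 1) → ℤ) :
    koszulSign (extendLast σ) d = koszulSign σ fun i => d i.castSucc := by
  rw [koszulSign, koszulSign, Finset.prod_filter, Finset.prod_filter, Fintype.prod_prod_type,
    Fintype.prod_prod_type, Fin.prod_univ_castSucc]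
  simp only [Fin.prod_univ_castSucc, extendLast_castSucc, extendLast_last,
    Fin.castSucc_lt_castSucc_iff, (Fin.castSucc_lt_last _).not_gt, (Fin.le_last _).not_gt, and_false, false_and, if_false,
    mul_one, Finset.prod_const_one]

section Graded

variable {K : Type*} [Field K] {V : Type*} [AddCommGroup V] [Module K V]
variable (𝒱 : ℤ → Submodule K V) [DirectSum.Decomposition 𝒱]

/-! ### The action on tensor powers -/

theorem comp_sum {M N P ι : Type*} [AddCommGroup M] [Module K M] [AddCommGroup N] [Module K N]
    [AddCommGroup P] [Module K P] (s : Finset ι) (g : N →ₗ[K] P) (f : ι → M →ₗ[K] N) :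
    g ∘ₗ ∑ i ∈ s, f i = ∑ i ∈ s, g ∘ₗ f i := by
  ext x
  simp

theorem sum_comp {M N P ι : Type*} [AddCommGroup M] [Module K M] [AddCommGroup N] [Module K N]
    [AddCommGroup P] [Module K P] (s : Finset ι) (g : ι → N →ₗ[K] P) (f : M →ₗ[K] N) :
    (∑ i ∈ s, g i) ∘ₗ f = ∑ i ∈ s, g i ∘ₗ f := by
  ext x
  simp

/-- A linear map on a tensor power is determined by its values on tensors of homogeneous
elements. -/
theorem ext_homogeneous {n : ℕ} {W : Type*} [AddCommGroup W] [Module K W]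
    {f g : ⨂[K]^n V →ₗ[K] W}
    (h : ∀ (x : Fin n → V) (d : Fin n → ℤ), (∀ i, x i ∈ 𝒱 (d i)) →
      f (PiTensorProduct.tprod K x) = g (PiTensorProduct.tprod K x)) : f = g := by
  classical
  refine PiTensorProduct.ext (MultilinearMap.ext fun x => ?_)
  have hx : x = fun i => ∑ j ∈ (DirectSum.decompose 𝒱 (x i)).support,
      (DirectSum.decompose 𝒱 (x i) j : V) :=
    funext fun i => (DirectSum.sum_support_decompose 𝒱 (x i)).symm
  rw [hx, MultilinearMap.map_sum_finset, MultilinearMap.map_sum_finset]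
  exact Finset.sum_congr rfl fun r _ => h _ r fun i => SetLike.coe_mem _

theorem rho_one (n : ℕ) : rho 𝒱 (1 : Equiv.Perm (Fin n)) = LinearMap.id :=
  ext_homogeneous 𝒱 fun x d hx => by simp [rho_tprod 𝒱 1 x d hx, koszulSign_one]

theorem rho_comp_rho {n : ℕ} (σ τ : Equiv.Perm (Fin n)) :
    rho 𝒱 τ ∘ₗ rho 𝒱 σ = rho 𝒱 (σ * τ) :=
  ext_homogeneous 𝒱 fun x d hx => by
    rw [LinearMap.comp_apply, rho_tprod 𝒱 σ x d hx, map_smul,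
      rho_tprod 𝒱 τ _ (fun i => d (σ i)) fun i => hx _, rho_tprod 𝒱 (σ * τ) x d hx, smul_smul,
      koszulSign_mul]
    simp

theorem tensorOne_rho {n : ℕ} (σ : Equiv.Perm (Fin n)) :
    tensorOne (rho 𝒱 σ) = rho 𝒱 (extendLast σ) :=
  ext_homogeneous 𝒱 fun x d hx => by
    have h := tensorOne_rho_tprod 𝒱 σ (fun i => x i.castSucc) (x (Fin.last n))
      (fun i => d i.castSucc) fun i => hx _
    have hx' : (Fin.snoc (fun i => x i.castSucc) (x (Fin.last n)) : Fin (n + 1) → V) = x :=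
      Fin.snoc_init_self x
    rw [hx'] at h
    rw [h, rho_tprod 𝒱 _ x d hx, koszulSign_extendLast]
    congr 2
    funext i
    refine Fin.lastCases ?_ (fun i => ?_) i <;> simp

theorem tensorOne_sum {n : ℕ} {ι : Type*} (s : Finset ι)
    (f : ι → ⨂[K]^n V →ₗ[K] ⨂[K]^n V) :
    tensorOne (∑ i ∈ s, f i) = ∑ i ∈ s, tensorOne (f i) := by
  let T : (⨂[K]^n V →ₗ[K] ⨂[K]^n V) →+ (⨂[K]^(n + 1) V →ₗ[K] ⨂[K]^(n + 1) V) :=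
    AddMonoidHom.mk' tensorOne fun f g => by
      simp only [tensorOne, TensorProduct.map_add_left, LinearMap.add_comp, LinearMap.comp_add]
  exact map_sum T f s

theorem tensorOne_rhoW (n : ℕ) :
    tensorOne (rhoW 𝒱 n) = ∑ σ : Equiv.Perm (Fin n), rho 𝒱 (extendLast σ) := by
  simp only [rhoW, tensorOne_sum, tensorOne_rho]

theorem rho_comp_rhoW {n : ℕ} (σ : Equiv.Perm (Fin n)) : rho 𝒱 σ ∘ₗ rhoW 𝒱 n = rhoW 𝒱 n := by
  simp only [rhoW, comp_sum, rho_comp_rho]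
  exact Equiv.sum_comp (Equiv.mulRight σ) fun τ => rho 𝒱 τ

theorem rhoW_comp_rho {n : ℕ} (σ : Equiv.Perm (Fin n)) : rhoW 𝒱 n ∘ₗ rho 𝒱 σ = rhoW 𝒱 n := by
  simp only [rhoW, sum_comp, rho_comp_rho]
  exact Equiv.sum_comp (Equiv.mulLeft σ) fun τ => rho 𝒱 τ

theorem rho_comp_tensorOne_rhoW {n : ℕ} (σ : Equiv.Perm (Fin (n + 1)))
    (hσ : σ (Fin.last n) = Fin.last n) :
    rho 𝒱 σ ∘ₗ tensorOne (rhoW 𝒱 n) = tensorOne (rhoW 𝒱 n) := by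
  obtain ⟨τ, rfl⟩ := exists_extendLast_eq σ hσ
  simp only [tensorOne_rhoW, comp_sum, rho_comp_rho, ← extendLast_mul]
  exact Equiv.sum_comp (Equiv.mulRight τ) fun π => rho 𝒱 (extendLast π)

theorem tensorOne_rhoW_comp_rho {n : ℕ} (τ : Equiv.Perm (Fin n)) :
    tensorOne (rhoW 𝒱 n) ∘ₗ rho 𝒱 (extendLast τ) = tensorOne (rhoW 𝒱 n) := by
  simp only [tensorOne_rhoW, sum_comp, rho_comp_rho, ← extendLast_mul]
  exact Equiv.sum_comp (Equiv.mulLeft τ) fun π => rho 𝒱 (extendLast π)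

theorem tensorOne_rhoW_comp_rhoW (n : ℕ) :
    tensorOne (rhoW 𝒱 n) ∘ₗ rhoW 𝒱 (n + 1) = (n.factorial : K) • rhoW 𝒱 (n + 1) := by
  rw [tensorOne_rhoW, sum_comp]
  simp only [rho_comp_rhoW, Finset.sum_const, Finset.card_univ, Fintype.card_perm,
    Fintype.card_fin, Nat.cast_smul_eq_nsmul]

theorem IsDegreeNegOne.comp_sum_rho {μ : Operations K V} (hμ : IsDegreeNegOne 𝒱 μ)
    (s : ∀ n, Finset (Equiv.Perm (Fin (n + 1)))) :
    IsDegreeNegOne 𝒱 fun n => μ n ∘ₗ ∑ σ ∈ s n, rho 𝒱 σ := by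
  intro n d x hx
  simp only [LinearMap.comp_apply, LinearMap.sum_apply, map_sum]
  refine Submodule.sum_mem _ fun σ _ => ?_
  rw [rho_tprod 𝒱 σ x d hx, map_smul, ← Equiv.sum_comp σ d]
  exact Submodule.smul_mem _ _ (hμ n _ _ fun i => hx _)

end Graded

/-! ### Moving a single factor past a block -/

/-- The permutation `P` for which `x ↦ x ∘ P` moves the entry in place `p + b + 1` to place `p`,
past the block of the `b + 1` entries in the places `p, …, p + b`. -/
noncomputable def blockCycle {N : ℕ} (p b : ℕ) (h : p + b + 1 < N) : Equiv.Perm (Fin N) :=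
  Equiv.ofBijective (fun i => ⟨if (i : ℕ) < p then (i : ℕ) else if (i : ℕ) = p then p + b + 1
      else if (i : ℕ) ≤ p + b + 1 then (i : ℕ) - 1 else i, by split_ifs <;> omega⟩) <|
    Finite.injective_iff_bijective.1 fun i j hij => by
      rw [Fin.mk.injEq] at hij
      apply Fin.ext
      split_ifs at hij <;> omega

theorem blockCycle_val {N p b : ℕ} (h : p + b + 1 < N) (i : Fin N) :
    (blockCycle p b h i : ℕ) = if (i : ℕ) < p then (i : ℕ) else if (i : ℕ) = p then p + b + 1
      else if (i : ℕ) ≤ p + b + 1 then (i : ℕ) - 1 else i :=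
  rfl

theorem negOnePow_sum {ι : Type*} (s : Finset ι) (f : ι → ℤ) :
    (∑ i ∈ s, f i).negOnePow = ∏ i ∈ s, (f i).negOnePow := by
  classical
  induction s using Finset.induction_on with
  | empty => simp
  | insert i s hi ih => rw [Finset.sum_insert hi, Finset.prod_insert hi, Int.negOnePow_add, ih]

theorem koszulSign_blockCycle {N p b : ℕ} (h : p + b + 1 < N) (d : Fin N → ℤ) :
    koszulSign (blockCycle p b h) d =
      (d ⟨p + b + 1, h⟩ * ∑ s : Fin (b + 1), d ⟨p + s, by omega⟩).negOnePow := by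
  rw [Finset.mul_sum, negOnePow_sum, koszulSign]
  -- The inverted pairs are `(p, p + 1 + s)`, `s = 0, …, b`.
  symm
  refine Finset.prod_bij (fun (s : Fin (b + 1)) _ =>
    ((⟨p, by omega⟩, ⟨p + 1 + s, by omega⟩) : Fin N × Fin N)) ?_ ?_ ?_ ?_
  · intro s _
    rw [Finset.mem_filter, Fin.lt_def, Fin.lt_def, blockCycle_val, blockCycle_val]
    refine ⟨Finset.mem_univ _, by simp only; omega, ?_⟩
    simp only
    split_ifs <;> omega
  · intro s _ t _ hst
    simp only [Prod.mk.injEq, Fin.mk.injEq, true_and] at hst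
    apply Fin.ext
    omega
  · intro q hq
    obtain ⟨i, j⟩ := q
    rw [Finset.mem_filter, Fin.lt_def, Fin.lt_def, blockCycle_val, blockCycle_val] at hq
    obtain ⟨-, hij, hlt⟩ := hq
    simp only at hij hlt
    have hi : (i : ℕ) = p ∧ (j : ℕ) ≤ p + b + 1 := by
      split_ifs at hlt <;> omega
    refine ⟨⟨j - (p + 1), by omega⟩, Finset.mem_univ _, ?_⟩
    simp only [Prod.mk.injEq, Fin.ext_iff]
    omega
  · intro s _
    congr 2
    · congr 1
      apply Fin.ext
      rw [blockCycle_val]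
      simp
    · congr 1
      apply Fin.ext
      rw [blockCycle_val]
      simp only
      split_ifs <;> omega

theorem swap_castSucc_succ_val {n : ℕ} (j : Fin n) (i : Fin (n + 1)) :
    (Equiv.swap j.castSucc j.succ i : ℕ) =
      if (i : ℕ) = j then (j : ℕ) + 1 else if (i : ℕ) = j + 1 then (j : ℕ) else i := by
  rw [Equiv.swap_apply_def]
  simp only [Fin.ext_iff, Fin.val_castSucc, Fin.val_succ]
  split_ifs <;> simp

section Graded

variable {K : Type*} [Field K] {V : Type*} [AddCommGroup V] [Module K V]
variable (𝒱 : ℤ → Submodule K V) [DirectSum.Decomposition 𝒱]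

/-! ### Insertions -/

theorem insertFun_eq_update {a b n : ℕ} (h : a + b = n) (m : Fin (a + 1))
    (f : ⨂[K]^(b + 1) V →ₗ[K] V) (x : Fin (n + 1) → V) :
    insertFun 𝒱 h m f x = Function.update (insertFun 𝒱 h m 0 x) m
      (f (PiTensorProduct.tprod K fun s : Fin (b + 1) => x ⟨m + s, by omega⟩)) := by
  funext t
  by_cases ht : t = m
  · subst ht
    simp [insertFun]
  · rw [Function.update_of_ne ht]
    simp [insertFun, ht]

theorem insertMap_sum {a b n : ℕ} (h : a + b = n) (m : Fin (a + 1)) {ι : Type*} (s : Finset ι)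
    (f : ι → ⨂[K]^(b + 1) V →ₗ[K] V) :
    insertMap 𝒱 h m (∑ i ∈ s, f i) = ∑ i ∈ s, insertMap 𝒱 h m (f i) := by
  refine PiTensorProduct.ext (MultilinearMap.ext fun x => ?_)
  simp only [LinearMap.compMultilinearMap_apply, LinearMap.sum_apply, insertMap_tprod]
  rw [insertFun_eq_update, LinearMap.sum_apply, MultilinearMap.map_update_sum]
  exact Finset.sum_congr rfl fun i _ => by rw [← insertFun_eq_update]

theorem signMap_mem {i : ℤ} {x : V} (hx : x ∈ 𝒱 i) : signMap 𝒱 x ∈ 𝒱 i := by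
  rw [signMap_of_mem 𝒱 hx]
  exact Submodule.smul_mem _ _ hx

/-- The degrees of the factors of `(I_m ⊗ f ⊗ I_{a-m}) (x₀ ⊗ ⋯ ⊗ xₙ)` when `f` has degree `-1` and
`d` lists the degrees of the `xᵢ`. -/
def insertDeg {a b n : ℕ} (h : a + b = n) (m : Fin (a + 1)) (d : Fin (n + 1) → ℤ)
    (t : Fin (a + 1)) : ℤ :=
  if t < m then d ⟨t, by omega⟩
  else if t = m then (∑ s : Fin (b + 1), d ⟨m + s, by omega⟩) - 1
  else d ⟨t + b, by omega⟩

/-- A multilinear operation is homogeneous of degree `-1`. -/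
def HasDegreeNegOne {k : ℕ} (f : ⨂[K]^k V →ₗ[K] V) : Prop :=
  ∀ (d : Fin k → ℤ) (x : Fin k → V), (∀ i, x i ∈ 𝒱 (d i)) →
    f (PiTensorProduct.tprod K x) ∈ 𝒱 ((∑ i, d i) - 1)

theorem insertFun_mem {a b n : ℕ} (h : a + b = n) (m : Fin (a + 1))
    {f : ⨂[K]^(b + 1) V →ₗ[K] V} (hf : HasDegreeNegOne 𝒱 f) {x : Fin (n + 1) → V}
    {d : Fin (n + 1) → ℤ} (hx : ∀ i, x i ∈ 𝒱 (d i)) (t : Fin (a + 1)) :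
    insertFun 𝒱 h m f x t ∈ 𝒱 (insertDeg h m d t) := by
  unfold insertFun insertDeg
  split_ifs
  · exact signMap_mem 𝒱 (hx _)
  · exact hf _ _ fun s => hx _
  · exact hx _

/-- Exchanging two neighbouring factors neither of which is the output of `f` amounts to exchanging
two neighbouring inputs. -/
theorem rho_swap_comp_insertMap_of_ne {a b n : ℕ} (h : a + b = n)
    {f : ⨂[K]^(b + 1) V →ₗ[K] V} (hf : HasDegreeNegOne 𝒱 f) (k : Fin a) (m : Fin (a + 1))
    (h1 : m ≠ k.castSucc) (h2 : m ≠ k.succ) :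
    ∃ P : Equiv.Perm (Fin (n + 1)), (k.succ ≠ Fin.last a → P (Fin.last n) = Fin.last n) ∧
      rho 𝒱 (Equiv.swap k.castSucc k.succ) ∘ₗ insertMap 𝒱 h m f =
        insertMap 𝒱 h m f ∘ₗ rho 𝒱 P := by
  have h1' : (m : ℕ) ≠ k := fun h' => h1 (Fin.ext h')
  have h2' : (m : ℕ) ≠ k + 1 := fun h' => h2 (Fin.ext h')
  let j : Fin n := ⟨if (k : ℕ) < m then k else k + b, by split_ifs <;> omega⟩
  have hj : (j : ℕ) = if (k : ℕ) < m then (k : ℕ) else k + b := rfl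
  refine ⟨Equiv.swap j.castSucc j.succ, fun hk => ?_, ext_homogeneous 𝒱 fun x d hx => ?_⟩
  · have hk' : (k : ℕ) + 1 ≠ a := fun h' => hk (Fin.ext h')
    apply Fin.ext
    rw [swap_castSucc_succ_val, hj, Fin.val_last]
    split_ifs <;> omega
  have hD1 : insertDeg h m d k.castSucc = d j.castSucc := by
    unfold insertDeg
    split_ifs with h3 h4
    · congr 1
      apply Fin.ext
      simp only [Fin.lt_def, Fin.val_castSucc] at *
      rw [hj, if_pos h3]
    · exact absurd h4.symm h1
    · congr 1
      apply Fin.ext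
      simp only [Fin.lt_def, Fin.val_castSucc] at *
      rw [hj, if_neg h3]
  have hD2 : insertDeg h m d k.succ = d j.succ := by
    unfold insertDeg
    split_ifs with h3 h4
    · congr 1
      apply Fin.ext
      simp only [Fin.lt_def, Fin.val_succ] at *
      rw [hj, if_pos (by omega)]
    · exact absurd h4.symm h2
    · congr 1
      apply Fin.ext
      simp only [Fin.lt_def, Fin.val_succ] at *
      rw [hj, if_neg (by omega)]
      omega
  rw [LinearMap.comp_apply, LinearMap.comp_apply, insertMap_tprod,
    rho_tprod 𝒱 _ _ _ (insertFun_mem 𝒱 h m hf hx), rho_tprod 𝒱 _ x d hx, map_smul, insertMap_tprod,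
    koszulSign_swap, koszulSign_swap, hD1, hD2]
  congr 2
  funext t
  have hs := swap_castSucc_succ_val k t
  simp only [insertFun]
  by_cases ht : t < m
  · have ht' : Equiv.swap k.castSucc k.succ t < m := by
      rw [Fin.lt_def] at *
      rw [hs]
      split_ifs <;> omega
    rw [if_pos ht, if_pos ht']
    congr 2
    apply Fin.ext
    rw [swap_castSucc_succ_val j, hj]
    simp only [hs]
    rw [Fin.lt_def] at *
    split_ifs <;> omega
  by_cases ht2 : t = m
  · subst ht2
    have ht' : Equiv.swap k.castSucc k.succ t = t := Equiv.swap_apply_of_ne_of_ne h1 h2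
    rw [ht', if_neg ht, if_neg ht, if_pos rfl, if_pos rfl]
    congr 2
    funext s
    congr 1
    apply Fin.ext
    rw [swap_castSucc_succ_val, hj]
    simp only
    split_ifs <;> omega
  · have ht3 : (t : ℕ) ≠ m := fun h' => ht2 (Fin.ext h')
    rw [Fin.lt_def] at ht
    have ht' : (m : ℕ) < Equiv.swap k.castSucc k.succ t := by
      rw [hs]
      split_ifs <;> omega
    rw [if_neg (by rw [Fin.lt_def]; omega), if_neg (by rw [Fin.ext_iff]; omega),
      if_neg (by rw [Fin.lt_def]; omega), if_neg ht2]
    congr 1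
    apply Fin.ext
    rw [swap_castSucc_succ_val j, hj]
    simp only [hs]
    split_ifs <;> omega

/-- Exchanging the output of `f` with the factor after it amounts to moving that factor past all
the inputs of `f`. Of the sign `(-1) ^ (|x| (∑ |yᵢ| - 1))` for the exchange of `x` and
`f (y₀ ⊗ ⋯ ⊗ y_b)`, the part `(-1) ^ |x|` is the Koszul sign of `f` passing `x`. -/
theorem rho_swap_comp_insertMap_castSucc {a b n : ℕ} (h : a + b = n)
    {f : ⨂[K]^(b + 1) V →ₗ[K] V} (hf : HasDegreeNegOne 𝒱 f) (k : Fin a) :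
    ∃ P : Equiv.Perm (Fin (n + 1)), (k.succ ≠ Fin.last a → P (Fin.last n) = Fin.last n) ∧
      rho 𝒱 (Equiv.swap k.castSucc k.succ) ∘ₗ insertMap 𝒱 h k.castSucc f =
        insertMap 𝒱 h k.succ f ∘ₗ rho 𝒱 P := by
  have hlt : (k : ℕ) + b + 1 < n + 1 := by omega
  refine ⟨blockCycle k b hlt, fun hk => ?_, ext_homogeneous 𝒱 fun x d hx => ?_⟩
  · have hk' : (k : ℕ) + 1 ≠ a := fun h' => hk (Fin.ext h')
    apply Fin.ext
    rw [blockCycle_val, Fin.val_last]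
    split_ifs <;> omega
  let X : Fin (a + 1) → V := fun t =>
    insertFun 𝒱 h k.castSucc f x (Equiv.swap k.castSucc k.succ t)
  have hX : X k.castSucc = x ⟨k + b + 1, hlt⟩ := by
    simp only [X, Equiv.swap_apply_left, insertFun]
    rw [if_neg (by simp [Fin.lt_def]), if_neg (by simp [Fin.ext_iff])]
    congr 1
    apply Fin.ext
    simp only [Fin.val_succ]
    omega
  have hD1 : insertDeg h k.castSucc d k.castSucc =
      (∑ s : Fin (b + 1), d ⟨k + s, by omega⟩) - 1 := by
    simp [insertDeg]
  have hD2 : insertDeg h k.castSucc d k.succ = d ⟨k + b + 1, hlt⟩ := by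
    unfold insertDeg
    rw [if_neg (by simp [Fin.lt_def]), if_neg (by simp [Fin.ext_iff])]
    congr 1
    apply Fin.ext
    simp only [Fin.val_succ]
    omega
  have hupd : insertFun 𝒱 h k.succ f (fun i => x (blockCycle k b hlt i)) =
      Function.update X k.castSucc
        ((((d ⟨k + b + 1, hlt⟩).negOnePow : ℤ) : K) • X k.castSucc) := by
    funext t
    by_cases ht : t = k.castSucc
    · subst ht
      rw [Function.update_self, hX, ← signMap_of_mem 𝒱 (hx _)]
      simp only [insertFun]
      rw [if_pos (by simp [Fin.lt_def])]
      congr 2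
      apply Fin.ext
      rw [blockCycle_val]
      simp
    rw [Function.update_of_ne ht]
    have hs := swap_castSucc_succ_val k t
    have ht' : (t : ℕ) ≠ k := fun h' => ht (Fin.ext h')
    simp only [X, insertFun]
    by_cases h1 : (t : ℕ) < k
    · rw [if_pos (by rw [Fin.lt_def, Fin.val_succ]; omega), if_pos (by
        rw [Fin.lt_def, hs, Fin.val_castSucc]
        split_ifs <;> omega)]
      congr 2
      apply Fin.ext
      rw [blockCycle_val]
      simp only [hs]
      split_ifs <;> omega
    by_cases h2 : t = k.succ
    · subst h2
      rw [Equiv.swap_apply_right, if_neg (lt_irrefl _), if_pos rfl, if_neg (lt_irrefl _),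
        if_pos rfl]
      congr 2
      funext s
      congr 1
      apply Fin.ext
      rw [blockCycle_val]
      simp only [Fin.val_succ, Fin.val_castSucc]
      split_ifs <;> omega
    · have h2' : (t : ℕ) ≠ k + 1 := fun h' => h2 (Fin.ext h')
      have hs' : (Equiv.swap k.castSucc k.succ t : ℕ) = t := by
        rw [hs, if_neg ht', if_neg h2']
      rw [if_neg (by rw [Fin.lt_def, Fin.val_succ]; omega), if_neg h2,
        if_neg (by rw [Fin.lt_def, hs', Fin.val_castSucc]; omega),
        if_neg (by rw [Fin.ext_iff, hs', Fin.val_castSucc]; omega)]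
      congr 1
      apply Fin.ext
      rw [blockCycle_val]
      simp only [hs']
      split_ifs <;> omega
  rw [LinearMap.comp_apply, LinearMap.comp_apply, insertMap_tprod,
    rho_tprod 𝒱 _ _ _ (insertFun_mem 𝒱 h k.castSucc hf hx), rho_tprod 𝒱 _ x d hx, map_smul,
    insertMap_tprod, koszulSign_swap, koszulSign_blockCycle, hD1, hD2, hupd,
    MultilinearMap.map_update_smul, Function.update_eq_self, smul_smul, sub_mul, one_mul,
    Int.negOnePow_sub, mul_comm (∑ s : Fin (b + 1), d ⟨k + s, by omega⟩)]
  push_cast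
  rfl

theorem rho_swap_comp_insertMap {a b n : ℕ} (h : a + b = n)
    {f : ⨂[K]^(b + 1) V →ₗ[K] V} (hf : HasDegreeNegOne 𝒱 f) (k : Fin a) (m : Fin (a + 1)) :
    ∃ P : Equiv.Perm (Fin (n + 1)), (k.succ ≠ Fin.last a → P (Fin.last n) = Fin.last n) ∧
      rho 𝒱 (Equiv.swap k.castSucc k.succ) ∘ₗ insertMap 𝒱 h m f =
        insertMap 𝒱 h (Equiv.swap k.castSucc k.succ m) f ∘ₗ rho 𝒱 P := by
  by_cases h1 : m = k.castSucc
  · subst h1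
    rw [Equiv.swap_apply_left]
    exact rho_swap_comp_insertMap_castSucc 𝒱 h hf k
  by_cases h2 : m = k.succ
  · subst h2
    rw [Equiv.swap_apply_right]
    obtain ⟨P, hP, hP'⟩ := rho_swap_comp_insertMap_castSucc 𝒱 h hf k
    refine ⟨P⁻¹, fun hk => ?_, ?_⟩
    · rw [Equiv.Perm.inv_eq_iff_eq, hP hk]
    · calc rho 𝒱 (Equiv.swap k.castSucc k.succ) ∘ₗ insertMap 𝒱 h k.succ f
          = rho 𝒱 (Equiv.swap k.castSucc k.succ) ∘ₗ (insertMap 𝒱 h k.succ f ∘ₗ rho 𝒱 P) ∘ₗ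
              rho 𝒱 P⁻¹ := by
            rw [LinearMap.comp_assoc, rho_comp_rho, inv_mul_cancel, rho_one, LinearMap.comp_id]
        _ = insertMap 𝒱 h k.castSucc f ∘ₗ rho 𝒱 P⁻¹ := by
            rw [← hP', ← LinearMap.comp_assoc, ← LinearMap.comp_assoc, rho_comp_rho,
              Equiv.swap_mul_self, rho_one, LinearMap.id_comp]
  · rw [Equiv.swap_apply_of_ne_of_ne h1 h2]
    exact rho_swap_comp_insertMap_of_ne 𝒱 h hf k m h1 h2

theorem insertMap_comp_rho_swap {a b n : ℕ} (h : a + b = n)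
    (f : ⨂[K]^(b + 1) V →ₗ[K] V) (k : Fin b) (m : Fin (a + 1)) :
    ∃ P : Equiv.Perm (Fin (n + 1)), (k.succ ≠ Fin.last b → P (Fin.last n) = Fin.last n) ∧
      insertMap 𝒱 h m (f ∘ₗ rho 𝒱 (Equiv.swap k.castSucc k.succ)) =
        insertMap 𝒱 h m f ∘ₗ rho 𝒱 P := by
  let j : Fin n := ⟨m + k, by omega⟩
  have hj : (j : ℕ) = m + k := rfl
  refine ⟨Equiv.swap j.castSucc j.succ, fun hk => ?_, ext_homogeneous 𝒱 fun x d hx => ?_⟩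
  · have hk' : (k : ℕ) + 1 ≠ b := fun h' => hk (Fin.ext h')
    apply Fin.ext
    rw [swap_castSucc_succ_val, hj, Fin.val_last]
    split_ifs <;> omega
  have hin : (fun s : Fin (b + 1) => x (Equiv.swap j.castSucc j.succ ⟨m + s, by omega⟩)) =
      fun s : Fin (b + 1) => x ⟨m + (Equiv.swap k.castSucc k.succ s : Fin (b + 1)), by omega⟩ := by
    funext s
    congr 1
    apply Fin.ext
    rw [swap_castSucc_succ_val, hj]
    simp only [swap_castSucc_succ_val]
    split_ifs <;> omega
  have hout : Function.update (insertFun 𝒱 h m 0 fun i => x (Equiv.swap j.castSucc j.succ i)) m =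
      Function.update (insertFun 𝒱 h m 0 x) m := by
    funext v t
    by_cases ht : t = m
    · subst ht
      simp
    have ht' : (t : ℕ) ≠ m := fun h' => ht (Fin.ext h')
    rw [Function.update_of_ne ht, Function.update_of_ne ht]
    simp only [insertFun]
    split_ifs with h1
    · congr 2
      apply Fin.ext
      rw [swap_castSucc_succ_val, hj]
      rw [Fin.lt_def] at h1
      split_ifs <;> simp only at * <;> omega
    · congr 1
      apply Fin.ext
      rw [swap_castSucc_succ_val, hj]
      rw [Fin.lt_def] at h1
      split_ifs <;> simp only at * <;> omega
  rw [LinearMap.comp_apply, rho_tprod 𝒱 _ x d hx, map_smul, insertMap_tprod, insertMap_tprod,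
    insertFun_eq_update, insertFun_eq_update 𝒱 h m f, hin, hout, LinearMap.comp_apply,
    rho_tprod 𝒱 _ _ (fun s : Fin (b + 1) => d ⟨m + s, by omega⟩) fun s => hx _, map_smul,
    MultilinearMap.map_update_smul, koszulSign_swap, koszulSign_swap]
  rfl

end Graded

/-! ### Generation by adjacent transpositions -/

theorem mem_of_swap_mem {n : ℕ} (S : Submonoid (Equiv.Perm (Fin (n + 1))))
    (hS : ∀ k : Fin n, Equiv.swap k.castSucc k.succ ∈ S) (σ : Equiv.Perm (Fin (n + 1))) :
    σ ∈ S := by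
  have h : Submonoid.closure (Set.range fun i : Fin n => Equiv.swap i.castSucc i.succ) ≤ S :=
    Submonoid.closure_le.2 (Set.range_subset_iff.2 hS)
  rw [Equiv.Perm.mclosure_swap_castSucc_succ] at h
  exact h (Submonoid.mem_top σ)

theorem extendLast_mem_of_swap_mem {n : ℕ} (S : Submonoid (Equiv.Perm (Fin (n + 1))))
    (hS : ∀ k : Fin n, k.succ ≠ Fin.last n → Equiv.swap k.castSucc k.succ ∈ S)
    (σ : Equiv.Perm (Fin n)) : extendLast σ ∈ S := by
  cases n with
  | zero =>
    rw [Subsingleton.elim σ 1, extendLast_one]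
    exact S.one_mem
  | succ n =>
    let E : Equiv.Perm (Fin (n + 1)) →* Equiv.Perm (Fin (n + 2)) :=
      { toFun := extendLast
        map_one' := extendLast_one _
        map_mul' := extendLast_mul }
    refine mem_of_swap_mem (S.comap E) (fun k => ?_) σ
    have h : E (Equiv.swap k.castSucc k.succ) =
        Equiv.swap k.castSucc.castSucc k.castSucc.succ := by
      rw [← Fin.castSucc_succ]
      exact extendLast_swap _ _
    rw [Submonoid.mem_comap, h]
    refine hS _ ?_
    rw [← Fin.castSucc_succ]
    exact (Fin.castSucc_lt_last _).ne

section Graded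

variable {K : Type*} [Field K] {V : Type*} [AddCommGroup V] [Module K V]
variable (𝒱 : ℤ → Submodule K V) [DirectSum.Decomposition 𝒱]

/-! ### Permutations absorbed by symmetrizers -/

/-- The permutations `τ` of the outputs of an insertion `I_m ⊗ f ⊗ I_{a-m}` which, on the range of
`W`, merely move the position of `f`. -/
def outputAbsorbed {a b n : ℕ} (h : a + b = n) (f : ⨂[K]^(b + 1) V →ₗ[K] V)
    (W : ⨂[K]^(n + 1) V →ₗ[K] ⨂[K]^(n + 1) V) : Submonoid (Equiv.Perm (Fin (a + 1))) where
  carrier := {τ | ∀ m, rho 𝒱 τ ∘ₗ insertMap 𝒱 h m f ∘ₗ W = insertMap 𝒱 h (τ⁻¹ m) f ∘ₗ W}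
  one_mem' m := by rw [rho_one, LinearMap.id_comp, inv_one, Equiv.Perm.one_apply]
  mul_mem' {σ τ} hσ hτ m := by
    rw [← rho_comp_rho, LinearMap.comp_assoc, hσ, hτ, mul_inv_rev, Equiv.Perm.mul_apply]

/-- The permutations of the inputs of the inserted operation which have no effect on the range of
`W`. -/
def inputAbsorbed {a b n : ℕ} (h : a + b = n)
    (W : ⨂[K]^(n + 1) V →ₗ[K] ⨂[K]^(n + 1) V) : Submonoid (Equiv.Perm (Fin (b + 1))) where
  carrier := {τ | ∀ (m : Fin (a + 1)) (f : ⨂[K]^(b + 1) V →ₗ[K] V),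
    insertMap 𝒱 h m (f ∘ₗ rho 𝒱 τ) ∘ₗ W = insertMap 𝒱 h m f ∘ₗ W}
  one_mem' m f := by rw [rho_one, LinearMap.comp_id]
  mul_mem' {σ τ} hσ hτ m f := by
    rw [← rho_comp_rho, ← LinearMap.comp_assoc, hσ, hτ]

theorem mem_outputAbsorbed {a b n : ℕ} (h : a + b = n) {f : ⨂[K]^(b + 1) V →ₗ[K] V}
    (hf : HasDegreeNegOne 𝒱 f) {W : ⨂[K]^(n + 1) V →ₗ[K] ⨂[K]^(n + 1) V}
    (hW : ∀ P : Equiv.Perm (Fin (n + 1)), rho 𝒱 P ∘ₗ W = W) (τ : Equiv.Perm (Fin (a + 1))) :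
    τ ∈ outputAbsorbed 𝒱 h f W :=
  mem_of_swap_mem _ (fun k m => by
    obtain ⟨P, -, hP⟩ := rho_swap_comp_insertMap 𝒱 h hf k m
    rw [← LinearMap.comp_assoc, hP, LinearMap.comp_assoc, hW, Equiv.swap_inv]) τ

theorem extendLast_mem_outputAbsorbed {a b n : ℕ} (h : a + b = n) {f : ⨂[K]^(b + 1) V →ₗ[K] V}
    (hf : HasDegreeNegOne 𝒱 f) {W : ⨂[K]^(n + 1) V →ₗ[K] ⨂[K]^(n + 1) V}
    (hW : ∀ P : Equiv.Perm (Fin (n + 1)), P (Fin.last n) = Fin.last n → rho 𝒱 P ∘ₗ W = W)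
    (τ : Equiv.Perm (Fin a)) : extendLast τ ∈ outputAbsorbed 𝒱 h f W :=
  extendLast_mem_of_swap_mem _ (fun k hk m => by
    obtain ⟨P, hlast, hP⟩ := rho_swap_comp_insertMap 𝒱 h hf k m
    rw [← LinearMap.comp_assoc, hP, LinearMap.comp_assoc, hW P (hlast hk), Equiv.swap_inv]) τ

theorem mem_inputAbsorbed {a b n : ℕ} (h : a + b = n)
    {W : ⨂[K]^(n + 1) V →ₗ[K] ⨂[K]^(n + 1) V}
    (hW : ∀ P : Equiv.Perm (Fin (n + 1)), rho 𝒱 P ∘ₗ W = W) (τ : Equiv.Perm (Fin (b + 1))) :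
    τ ∈ inputAbsorbed 𝒱 h W :=
  mem_of_swap_mem _ (fun k m f => by
    obtain ⟨P, -, hP⟩ := insertMap_comp_rho_swap 𝒱 h f k m
    rw [hP, LinearMap.comp_assoc, hW]) τ

theorem extendLast_mem_inputAbsorbed {a b n : ℕ} (h : a + b = n)
    {W : ⨂[K]^(n + 1) V →ₗ[K] ⨂[K]^(n + 1) V}
    (hW : ∀ P : Equiv.Perm (Fin (n + 1)), P (Fin.last n) = Fin.last n → rho 𝒱 P ∘ₗ W = W)
    (τ : Equiv.Perm (Fin b)) : extendLast τ ∈ inputAbsorbed 𝒱 h W :=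
  extendLast_mem_of_swap_mem _ (fun k hk m f => by
    obtain ⟨P, hlast, hP⟩ := insertMap_comp_rho_swap 𝒱 h f k m
    rw [hP, LinearMap.comp_assoc, hW P (hlast hk)]) τ

/-- Symmetrizing both operations only multiplies the sum over all insertions by the number of
terms, on the range of a map that absorbs the permutations involved: an inner permutation has no
effect, and an outer one permutes the positions `m` of the insertion. -/
theorem sum_comp_insertMap_sum_rho {a b n : ℕ} (h : a + b = n) (g : ⨂[K]^(a + 1) V →ₗ[K] V)
    (f : ⨂[K]^(b + 1) V →ₗ[K] V) (W : ⨂[K]^(n + 1) V →ₗ[K] ⨂[K]^(n + 1) V)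
    (s : Finset (Equiv.Perm (Fin (a + 1)))) (t : Finset (Equiv.Perm (Fin (b + 1))))
    (hs : ∀ τ ∈ s, τ ∈ outputAbsorbed 𝒱 h f W) (ht : ∀ τ ∈ t, τ ∈ inputAbsorbed 𝒱 h W) :
    ∑ m : Fin (a + 1), (g ∘ₗ ∑ τ ∈ s, rho 𝒱 τ) ∘ₗ
        insertMap 𝒱 h m (f ∘ₗ ∑ τ ∈ t, rho 𝒱 τ) ∘ₗ W =
      ((s.card : K) * (t.card : K)) • ∑ m : Fin (a + 1), g ∘ₗ insertMap 𝒱 h m f ∘ₗ W := by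
  have hin : ∀ m, insertMap 𝒱 h m (f ∘ₗ ∑ τ ∈ t, rho 𝒱 τ) ∘ₗ W =
      (t.card : K) • (insertMap 𝒱 h m f ∘ₗ W) := fun m => by
    rw [comp_sum, insertMap_sum, sum_comp, Finset.sum_congr rfl fun τ hτ => ht τ hτ m f,
      Finset.sum_const, Nat.cast_smul_eq_nsmul]
  have hout : ∀ τ ∈ s, ∑ m, (g ∘ₗ rho 𝒱 τ) ∘ₗ insertMap 𝒱 h m f ∘ₗ W =
      ∑ m, g ∘ₗ insertMap 𝒱 h m f ∘ₗ W := fun τ hτ => by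
    rw [← Equiv.sum_comp τ⁻¹ fun m => g ∘ₗ insertMap 𝒱 h m f ∘ₗ W]
    exact Finset.sum_congr rfl fun m _ => by rw [LinearMap.comp_assoc, hs τ hτ m]
  simp only [hin, LinearMap.comp_smul, ← Finset.smul_sum]
  simp only [comp_sum, sum_comp]
  rw [Finset.sum_comm, Finset.sum_congr rfl hout, Finset.sum_const, ← Nat.cast_smul_eq_nsmul K,
    smul_smul, mul_comm]

/-! ### Unshuffles -/

/-- The `(n, 1)`-unshuffle with last value `j`. -/
def unshuffleOne {n : ℕ} (j : Fin (n + 1)) : Equiv.Perm (Fin (n + 1)) :=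
  finSuccEquivLast.trans (finSuccEquiv' j).symm

@[simp]
theorem unshuffleOne_castSucc {n : ℕ} (j : Fin (n + 1)) (i : Fin n) :
    unshuffleOne j i.castSucc = j.succAbove i := by
  simp [unshuffleOne]

@[simp]
theorem unshuffleOne_last {n : ℕ} (j : Fin (n + 1)) : unshuffleOne j (Fin.last n) = j := by
  simp [unshuffleOne]

theorem unshuffleOne_injective {n : ℕ} :
    Function.Injective (unshuffleOne : Fin (n + 1) → Equiv.Perm (Fin (n + 1))) := fun j k h => by
  rw [← unshuffleOne_last j, h, unshuffleOne_last]

theorem exists_unshuffleOne_mul {n : ℕ} (σ : Equiv.Perm (Fin (n + 1))) :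
    ∃ τ, unshuffleOne (σ (Fin.last n)) * extendLast τ = σ := by
  obtain ⟨τ, hτ⟩ := exists_extendLast_eq ((unshuffleOne (σ (Fin.last n)))⁻¹ * σ) (by
    rw [Equiv.Perm.mul_apply, Equiv.Perm.inv_eq_iff_eq, unshuffleOne_last])
  exact ⟨τ, by rw [hτ, mul_inv_cancel_left]⟩

theorem isUnshuffleOne_iff {n : ℕ} (σ : Equiv.Perm (Fin (n + 1))) :
    IsUnshuffleOne σ ↔ ∃ j, unshuffleOne j = σ := by
  constructor
  · intro h
    obtain ⟨τ, hτ⟩ := exists_unshuffleOne_mul σ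
    refine ⟨σ (Fin.last n), ?_⟩
    -- An increasing permutation is the identity.
    have hmono : StrictMono τ := fun i k hik => by
      have hik' := h hik
      rw [← hτ] at hik'
      simpa [Fin.succAbove_lt_succAbove_iff] using hik'
    have hone : τ = 1 := by
      ext i
      have := Subsingleton.elim (hmono.orderIsoOfSurjective τ τ.surjective) (OrderIso.refl _)
      exact congrArg Fin.val (DFunLike.congr_fun this i)
    rw [hone, extendLast_one, mul_one] at hτ
    exact hτ
  · rintro ⟨j, rfl⟩ i k hik
    simpa [Fin.succAbove_lt_succAbove_iff] using hik

open scoped Classical in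
theorem filter_isUnshuffleOne (n : ℕ) :
    (Finset.univ.filter fun σ : Equiv.Perm (Fin (n + 1)) => IsUnshuffleOne σ) =
      Finset.univ.map ⟨unshuffleOne, unshuffleOne_injective⟩ := by
  ext σ
  simp [isUnshuffleOne_iff]

theorem betaHat_apply (μ : Operations K V) (n : ℕ) :
    betaHat 𝒱 μ n = μ n ∘ₗ ∑ σ ∈ Finset.univ.map ⟨unshuffleOne, unshuffleOne_injective⟩,
      rho 𝒱 σ := by
  rw [betaHat, filter_isUnshuffleOne]

/-- Every permutation of `n + 1` places is, in exactly one way, an `(n, 1)`-unshuffle times a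
permutation that fixes the last place. -/
theorem sum_unshuffleOne_mul {n : ℕ} {M : Type*} [AddCommMonoid M]
    (F : Equiv.Perm (Fin (n + 1)) → M) :
    ∑ j : Fin (n + 1), ∑ τ : Equiv.Perm (Fin n), F (unshuffleOne j * extendLast τ) =
      ∑ σ, F σ := by
  rw [← Fintype.sum_prod_type']
  refine Fintype.sum_bijective
    (fun p : Fin (n + 1) × Equiv.Perm (Fin n) => unshuffleOne p.1 * extendLast p.2) ⟨?_, ?_⟩ _ _
    fun _ => rfl
  · rintro ⟨j, σ⟩ ⟨k, τ⟩ h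
    obtain rfl : j = k := by
      simpa using congrArg (fun π : Equiv.Perm (Fin (n + 1)) => π (Fin.last n)) h
    simpa [extendLast_injective.eq_iff] using h
  · intro σ
    obtain ⟨τ, hτ⟩ := exists_unshuffleOne_mul σ
    exact ⟨(σ (Fin.last n), τ), hτ⟩

theorem comp_rhoW_eq_factorial_smul_betaHat {μ : Operations K V} (n : ℕ)
    (hμ : ∀ σ : Equiv.Perm (Fin n), μ n = μ n ∘ₗ tensorOne (rho 𝒱 σ)) :
    μ n ∘ₗ rhoW 𝒱 (n + 1) = (n.factorial : K) • betaHat 𝒱 μ n := by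
  have key : ∀ (j : Fin (n + 1)) (τ : Equiv.Perm (Fin n)),
      μ n ∘ₗ rho 𝒱 (unshuffleOne j * extendLast τ) = μ n ∘ₗ rho 𝒱 (unshuffleOne j) :=
    fun j τ => by
      rw [← rho_comp_rho, ← LinearMap.comp_assoc, ← tensorOne_rho, ← hμ τ]
  rw [rhoW, comp_sum, ← sum_unshuffleOne_mul]
  simp only [key, Finset.sum_const, Finset.card_univ, Fintype.card_perm, Fintype.card_fin]
  rw [← Finset.smul_sum, betaHat_apply, Finset.sum_map, comp_sum, Nat.cast_smul_eq_nsmul]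
  rfl

/-! ### The two commutators -/

theorem gammaHat_apply (μ : Operations K V) (n : ℕ) :
    gammaHat 𝒱 μ n = μ n ∘ₗ ∑ σ ∈ Finset.univ.map ⟨extendLast, extendLast_injective⟩,
      rho 𝒱 σ := by
  rw [gammaHat, tensorOne_rhoW, Finset.sum_map]
  rfl

theorem IsAInfinity.gammaHat [CharZero K] {m : Operations K V} (hm : IsAInfinity 𝒱 m) :
    IsPLInfinity 𝒱 (gammaHat 𝒱 m) where
  degree := by
    rw [funext (gammaHat_apply 𝒱 m)]
    exact hm.degree.comp_sum_rho 𝒱 _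
  symm n σ := by
    rw [HomotopyAlgebra.gammaHat, LinearMap.comp_assoc, tensorOne_rho, tensorOne_rhoW_comp_rho]
  relation n := by
    have key : ∀ p : Finset.HasAntidiagonal.antidiagonal n,
        ∑ k : Fin (p.1.1 + 1), ((p.1.1.factorial : K) * (p.1.2.factorial : K))⁻¹ •
          (HomotopyAlgebra.gammaHat 𝒱 m p.1.1 ∘ₗ
            insertMap 𝒱 (Finset.HasAntidiagonal.mem_antidiagonal.1 p.2) k
              (HomotopyAlgebra.gammaHat 𝒱 m p.1.2) ∘ₗ tensorOne (rhoW 𝒱 n)) =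
        (∑ k : Fin (p.1.1 + 1), m p.1.1 ∘ₗ
          insertMap 𝒱 (Finset.HasAntidiagonal.mem_antidiagonal.1 p.2) k (m p.1.2)) ∘ₗ
            tensorOne (rhoW 𝒱 n) := fun p => by
      rw [← Finset.smul_sum, gammaHat_apply, gammaHat_apply, sum_comp_insertMap_sum_rho, smul_smul,
        Finset.card_map, Finset.card_map, Finset.card_univ, Finset.card_univ, Fintype.card_perm,
        Fintype.card_perm, Fintype.card_fin, Fintype.card_fin, inv_mul_cancel₀, one_smul, sum_comp]
      · rfl
      · exact mul_ne_zero (Nat.cast_ne_zero.2 (Nat.factorial_ne_zero _))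
          (Nat.cast_ne_zero.2 (Nat.factorial_ne_zero _))
      · intro τ hτ
        obtain ⟨σ, -, rfl⟩ := Finset.mem_map.1 hτ
        exact extendLast_mem_outputAbsorbed 𝒱 _ (hm.degree _) (rho_comp_tensorOne_rhoW 𝒱) σ
      · intro τ hτ
        obtain ⟨σ, -, rfl⟩ := Finset.mem_map.1 hτ
        exact extendLast_mem_inputAbsorbed 𝒱 _ (rho_comp_tensorOne_rhoW 𝒱) σ
    simp only [key]
    rw [← sum_comp, hm.relation n, LinearMap.zero_comp]

theorem IsPLInfinity.betaHat [CharZero K] {p : Operations K V} (hp : IsPLInfinity 𝒱 p) :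
    IsLInfinity 𝒱 (betaHat 𝒱 p) where
  degree := hp.degree.comp_sum_rho 𝒱 _
  symm n σ := by
    have h := comp_rhoW_eq_factorial_smul_betaHat 𝒱 n (hp.symm n)
    have hn : (n.factorial : K) ≠ 0 := Nat.cast_ne_zero.2 (Nat.factorial_ne_zero n)
    apply smul_right_injective _ hn
    simp only
    rw [← LinearMap.smul_comp, ← h, LinearMap.comp_assoc, rhoW_comp_rho]
  relation n := by
    have hn : (n.factorial : K) ≠ 0 := Nat.cast_ne_zero.2 (Nat.factorial_ne_zero n)
    have key : ∀ q : Finset.HasAntidiagonal.antidiagonal n,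
        ∑ k : Fin (q.1.1 + 1), (((q.1.1 + 1).factorial : K) * ((q.1.2 + 1).factorial : K))⁻¹ •
          (HomotopyAlgebra.betaHat 𝒱 p q.1.1 ∘ₗ
            insertMap 𝒱 (Finset.HasAntidiagonal.mem_antidiagonal.1 q.2) k
              (HomotopyAlgebra.betaHat 𝒱 p q.1.2) ∘ₗ rhoW 𝒱 (n + 1)) =
        (n.factorial : K)⁻¹ •
          (∑ k : Fin (q.1.1 + 1), ((q.1.1.factorial : K) * (q.1.2.factorial : K))⁻¹ •
            (p q.1.1 ∘ₗ insertMap 𝒱 (Finset.HasAntidiagonal.mem_antidiagonal.1 q.2) k (p q.1.2) ∘ₗ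
              tensorOne (rhoW 𝒱 n))) ∘ₗ rhoW 𝒱 (n + 1) := fun q => by
      rw [← Finset.smul_sum, betaHat_apply, betaHat_apply, sum_comp_insertMap_sum_rho, smul_smul,
        Finset.card_map, Finset.card_map, Finset.card_univ, Finset.card_univ, Fintype.card_fin,
        Fintype.card_fin, ← Finset.smul_sum, LinearMap.smul_comp, sum_comp]
      · simp only [LinearMap.comp_assoc, tensorOne_rhoW_comp_rhoW, LinearMap.comp_smul,
          ← Finset.smul_sum, smul_smul]
        congr 1
        have h1 : ((q.1.1 : K) + 1) ≠ 0 := Nat.cast_add_one_ne_zero _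
        have h2 : ((q.1.2 : K) + 1) ≠ 0 := Nat.cast_add_one_ne_zero _
        have h3 : (q.1.1.factorial : K) ≠ 0 := Nat.cast_ne_zero.2 (Nat.factorial_ne_zero _)
        have h4 : (q.1.2.factorial : K) ≠ 0 := Nat.cast_ne_zero.2 (Nat.factorial_ne_zero _)
        rw [Nat.factorial_succ, Nat.factorial_succ]
        push_cast
        field_simp
      · exact fun τ _ => mem_outputAbsorbed 𝒱 _ (hp.degree _) (rho_comp_rhoW 𝒱) τ
      · exact fun τ _ => mem_inputAbsorbed 𝒱 _ (rho_comp_rhoW 𝒱) τ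
    simp only [key]
    rw [← Finset.smul_sum, ← sum_comp, hp.relation n, LinearMap.zero_comp, smul_zero]

end Graded

end HomotopyAlgebra

theorem theorem4p2 {K : Type*} [Field K] [CharZero K] {V : Type*} [AddCommGroup V] [Module K V]
    (𝒱 : ℤ → Submodule K V) [DirectSum.Decomposition 𝒱] :
    (∀ m : HomotopyAlgebra.Operations K V,
      HomotopyAlgebra.IsAInfinity 𝒱 m →
        HomotopyAlgebra.IsPLInfinity 𝒱 (HomotopyAlgebra.gammaHat 𝒱 m)) ∧
    (∀ p : HomotopyAlgebra.Operations K V,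
      HomotopyAlgebra.IsPLInfinity 𝒱 p →
        HomotopyAlgebra.IsLInfinity 𝒱 (HomotopyAlgebra.betaHat 𝒱 p)) :=
  ⟨fun _ hm => hm.gammaHat 𝒱, fun _ hp => hp.betaHat 𝒱⟩
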